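/- Call an automorphism $f$ of a finite-dimensional Lie algebra over $\mathbb{Q}$ Anosov if it is hyperbolic (no complex eigenvalue of $f$ has absolute value $1$) and integer-like (the characteristic polynomial of $f$ has integer coefficients and $|\det f| = 1$); a finite-dimensional rational Lie algebra is Anosov if it has an Anosov automorphism. For a Lie algebra $\mathfrak{n}$ put $\gamma_1(\mathfrak{n}) = \mathfrak{n}$ and $\gamma_{i+1}(\mathfrak{n}) = [\mathfrak{n}, \gamma_i(\mathfrak{n})]$ for $i \geq 1$. It has nilpotency class $c \geq 1$ if $\gamma_{c+1}(\mathfrak{n}) = 0$ and $\gamma_c(\mathfrak{n}) \neq 0$, and then its type is the $c$-tuple $(n_1, \ldots, n_c)$ with $n_i = \dim \gamma_i(\mathfrak{n})/\gamma_{i+1}(\mathfrak{n})$. Theorem. For every integer $c \geq 1$ and every integer $n > 2$ there exists an Anosov rational Lie algebra of nilpotency class $c$ and type $(n, \ldots, n)$ ($c$ entries). -/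

import Mathlib

open scoped TensorProduct

namespace AnosovLie

/-- A linear endomorphism of a rational vector space is hyperbolic if no complex eigenvalue of it
(that is, no eigenvalue of its complexification) has absolute value `1`. -/
def IsHyperbolic {V : Type*} [AddCommGroup V] [Module ℚ V] (f : V →ₗ[ℚ] V) : Prop :=
  ∀ z : ℂ, Module.End.HasEigenvalue (f.baseChange ℂ : Module.End ℂ (ℂ ⊗[ℚ] V)) z → ‖z‖ ≠ 1

/-- A linear endomorphism of a finite-dimensional rational vector space is integer-like if its
characteristic polynomial has integer coefficients and its determinant has absolute value `1`. -/
def IsIntegerLike {V : Type*} [AddCommGroup V] [Module ℚ V] [FiniteDimensional ℚ V]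
    (f : V →ₗ[ℚ] V) : Prop :=
  (∀ k : ℕ, ∃ a : ℤ, f.charpoly.coeff k = (a : ℚ)) ∧ |LinearMap.det f| = 1

/-- An automorphism of a finite-dimensional rational Lie algebra is Anosov if it is hyperbolic and
integer-like. -/
def IsAnosovAut {L : Type*} [LieRing L] [LieAlgebra ℚ L] [FiniteDimensional ℚ L]
    (f : L ≃ₗ⁅ℚ⁆ L) : Prop :=
  IsHyperbolic (f : L →ₗ[ℚ] L) ∧ IsIntegerLike (f : L →ₗ[ℚ] L)

/-- A finite-dimensional rational Lie algebra is Anosov if it has an Anosov automorphism. -/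
def IsAnosov (L : Type*) [LieRing L] [LieAlgebra ℚ L] [FiniteDimensional ℚ L] : Prop :=
  ∃ f : L ≃ₗ⁅ℚ⁆ L, IsAnosovAut f

/-- The lower central series of `L` as a sequence of subspaces, numbered from `0`:
`gamma L 0 = L` and `gamma L (i + 1) = [L, gamma L i]`. -/
def gamma (L : Type*) [LieRing L] [LieAlgebra ℚ L] (i : ℕ) : Submodule ℚ L :=
  (LieModule.lowerCentralSeries ℚ L L i).toSubmodule

/-- The dimension of the `i`-th lower central quotient `gamma L i / gamma L (i + 1)`. -/
noncomputable def gradedDim (L : Type*) [LieRing L] [LieAlgebra ℚ L] (i : ℕ) : ℕ :=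
  Module.finrank ℚ (gamma L i ⧸ (gamma L (i + 1)).submoduleOf (gamma L i))

/-- The type of a nilpotent Lie algebra of nilpotency class `c`: the `c`-tuple of the dimensions of
the successive quotients of the lower central series. -/
noncomputable def lieType (L : Type*) [LieRing L] [LieAlgebra ℚ L] : List ℕ :=
  (List.range (LieModule.nilpotencyLength L L)).map (gradedDim L)

end AnosovLie

/-! Take a commutative algebra `E` of dimension `n` with an endomorphism `σ`, and stack `c` copies
of it. Two elements `a`, `b` of layer 0 have bracket `a σ(b) - b σ(a)` in layer 1; layer 0 moves
each higher layer one step up by multiplication, and the higher layers commute with each other. If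
the values of the alternating form span `E`, the lower central series is the filtration by layers
(`Tower.gamma_eq_level`), so the type is `(n, …, n)`. For `n = 2` those values span at most a line.

A unit `u` acts by `u` on layer 0 and by `u ^ k * σ u` on layer `k ≥ 1`, and this respects the
bracket. If `u` and its inverse are integral, the action is integer-like; its eigenvalues are images
of these weights under homomorphisms `φ : E → ℂ`. Thus it is Anosov once `‖φ u‖` and all `‖φ u‖ ^ k
* ‖φ (σ u)‖` differ from 1 (`isAnosovAut_unitEquiv`).

Such data add up under products of algebras (`HasAnosovTowers.add`), so `n = 3, 4, 5` suffice. There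
`u = 2 cos (2π/N)` with `N = 7, 15, 11`, and `σ` is angle doubling, `x ↦ x ^ 2 - 2`. -/

namespace AnosovLie

/-! ### Graded Lie algebras over a commutative algebra with an endomorphism. -/

section Tower

variable {E : Type*} [CommRing E] [Algebra ℚ E]

/-- The graded space with `d + 1` copies of a commutative algebra `E` as layers; the endomorphism
`σ` of `E` determines its Lie bracket. -/
def Tower (_σ : E →ₐ[ℚ] E) (d : ℕ) : Type _ := Fin (d + 1) → E

namespace Tower

variable {σ : E →ₐ[ℚ] E} {d : ℕ}

instance : AddCommGroup (Tower σ d) := inferInstanceAs (AddCommGroup (Fin (d + 1) → E))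

instance : Module ℚ (Tower σ d) := inferInstanceAs (Module ℚ (Fin (d + 1) → E))

instance [FiniteDimensional ℚ E] : FiniteDimensional ℚ (Tower σ d) :=
  inferInstanceAs (FiniteDimensional ℚ (Fin (d + 1) → E))

@[ext] theorem ext {v w : Tower σ d} (h : ∀ i, v i = w i) : v = w := funext h

@[simp] theorem zero_apply (i : Fin (d + 1)) : (0 : Tower σ d) i = 0 := rfl

@[simp] theorem add_apply (v w : Tower σ d) (i : Fin (d + 1)) : (v + w) i = v i + w i := rfl

@[simp] theorem smul_apply (q : ℚ) (v : Tower σ d) (i : Fin (d + 1)) : (q • v) i = q • v i := rfl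

/-- The `j`-th layer of `v`, with `σ` applied to it if it is the bottom one. -/
def twist (v : Tower σ d) (j : Fin d) : E :=
  if j.val = 0 then σ (v 0) else v j.castSucc

theorem twist_add (v w : Tower σ d) (j : Fin d) :
    twist (v + w) j = twist v j + twist w j := by
  unfold twist; split_ifs <;> simp

theorem twist_smul (q : ℚ) (v : Tower σ d) (j : Fin d) : twist (q • v) j = q • twist v j := by
  unfold twist; split_ifs <;> simp

instance : Bracket (Tower σ d) (Tower σ d) where
  bracket v w := Fin.cons 0 fun j : Fin d => v 0 * twist w j - w 0 * twist v j

@[simp] theorem bracket_zero (v w : Tower σ d) : ⁅v, w⁆ 0 = 0 := rfl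

@[simp] theorem bracket_succ (v w : Tower σ d) (j : Fin d) :
    ⁅v, w⁆ j.succ = v 0 * twist w j - w 0 * twist v j := rfl

theorem twist_bracket_of_eq_zero (v w : Tower σ d) {j : Fin d} (hj : j.val = 0) :
    twist ⁅v, w⁆ j = 0 := by
  simp [twist, hj]

theorem twist_bracket_of_castSucc_eq (v w : Tower σ d) {j k : Fin d}
    (hj : j.castSucc = k.succ) : twist ⁅v, w⁆ j = v 0 * twist w k - w 0 * twist v k := by
  have : j.val ≠ 0 := by
    have := congrArg Fin.val hj
    simp at this
    omega
  rw [twist, if_neg this, hj, bracket_succ]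

theorem exists_castSucc_eq_succ {j : Fin d} (hj : j.val ≠ 0) :
    ∃ k : Fin d, j.castSucc = k.succ :=
  ⟨⟨j.val - 1, by omega⟩, by ext; simp; omega⟩

/-- Jacobi: a bracket has no component in layer 0, so a double bracket vanishes in layer 1. In
higher layers only products with bottom components occur, and commutativity of `E` cancels them. -/
instance : LieRing (Tower σ d) where
  add_lie x y z := by
    ext i
    cases i using Fin.cases <;> simp [twist_add]
    ring
  lie_add x y z := by
    ext i
    cases i using Fin.cases <;> simp [twist_add]
    ring
  lie_self x := by
    ext i
    cases i using Fin.cases <;> simp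
  leibniz_lie x y z := by
    ext i
    cases i using Fin.cases with
    | zero => simp
    | succ j =>
      by_cases hj : j.val = 0
      · simp [twist_bracket_of_eq_zero _ _ hj]
      · obtain ⟨k, hk⟩ := exists_castSucc_eq_succ hj
        simp only [add_apply, bracket_succ, bracket_zero, twist_bracket_of_castSucc_eq _ _ hk]
        ring

instance : LieAlgebra ℚ (Tower σ d) where
  lie_smul q x y := by
    ext i
    cases i using Fin.cases <;> simp [twist_smul, smul_sub]

/-- The elements of a tower that vanish below layer `k`. -/
def level (σ : E →ₐ[ℚ] E) (d k : ℕ) : Submodule ℚ (Tower σ d) where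
  carrier := {v | ∀ i, i.val < k → v i = 0}
  add_mem' hv hw i hi := by simp [hv i hi, hw i hi]
  zero_mem' _ _ := rfl
  smul_mem' q v hv i hi := by simp [hv i hi]

theorem mem_level {k : ℕ} {v : Tower σ d} : v ∈ level σ d k ↔ ∀ i, i.val < k → v i = 0 := Iff.rfl

/-- The element of a tower with a single nonzero layer. -/
def single (σ : E →ₐ[ℚ] E) (i : Fin (d + 1)) : E →ₗ[ℚ] Tower σ d :=
  LinearMap.single ℚ (fun _ => E) i

theorem single_apply (i j : Fin (d + 1)) (e : E) :
    single σ i e j = if j = i then e else 0 := by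
  simp only [single]
  exact Pi.single_apply i e j

theorem single_self (i : Fin (d + 1)) (e : E) : single σ i e i = e := by simp [single_apply]

theorem sum_single (v : Tower σ d) : ∑ i, single σ i (v i) = v :=
  Finset.univ_sum_single (M := fun _ : Fin (d + 1) => E) v

/-- The index is a variable with value 0 because `Fin d` is empty for `d = 0`. -/
theorem bracket_single_zero {j : Fin d} (hj : j.val = 0) (a b : E) :
    ⁅single σ (d := d) 0 a, single σ (d := d) 0 b⁆ = single σ (d := d) j.succ (a * σ b - b * σ a) := by
  ext i
  cases i using Fin.cases with
  | zero => simp [single_apply, (Fin.succ_ne_zero j).symm]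
  | succ k =>
    rw [bracket_succ, single_self, single_self, single_apply]
    by_cases hk : k.val = 0
    · have : k = j := Fin.ext (hk.trans hj.symm)
      simp [twist, this, hj, single_self]
    · have h1 : k ≠ j := fun h => hk (h ▸ hj)
      have h2 : k.castSucc ≠ 0 := fun h => hk (by simpa using congrArg Fin.val h)
      simp [twist, hk, h1, single_apply, h2]

theorem bracket_single_one {j : Fin d} (hj : j.val ≠ 0) (e : E) :
    ⁅single σ (d := d) 0 1, single σ j.castSucc e⁆ = single σ j.succ e := by
  have h0 : (0 : Fin (d + 1)) ≠ j.castSucc :=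
    fun h => hj (by simpa using (congrArg Fin.val h).symm)
  ext i
  cases i using Fin.cases with
  | zero => simp [single_apply, (Fin.succ_ne_zero j).symm]
  | succ k =>
    rw [bracket_succ, single_self, single_apply, single_apply, if_neg h0]
    by_cases hk : k.val = 0
    · have : k ≠ j := fun h => hj (h ▸ hk)
      simp [twist, hk, this, single_apply, h0]
    · simp [twist, hk, single_apply]

theorem bracket_mem_level {k : ℕ} (x : Tower σ d) {y : Tower σ d} (hy : y ∈ level σ d k) :
    ⁅x, y⁆ ∈ level σ d (k + 1) := by
  intro i hi
  cases i using Fin.cases with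
  | zero => rfl
  | succ j =>
    have hj : j.val < k := by simpa using hi
    have h0 : y 0 = 0 := hy 0 (by simp; omega)
    have h1 : y j.castSucc = 0 := hy _ (by simpa using hj)
    simp [twist, h0, h1]

/-- The values of the alternating form `(a, b) ↦ a σ(b) - b σ(a)` span `E`. -/
def _root_.AnosovLie.TwistSpans (σ : E →ₐ[ℚ] E) : Prop :=
  Submodule.span ℚ (Set.range fun p : E × E => p.1 * σ p.2 - p.2 * σ p.1) = ⊤

/-- Brackets raise the level by one. Conversely, layer 1 is reached by the spanning hypothesis, and
each later layer by bracketing with the unit of `E` placed in layer 0. -/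
theorem gamma_eq_level (hσ : TwistSpans σ) (k : ℕ) : gamma (Tower σ d) k = level σ d k := by
  induction k with
  | zero =>
    rw [gamma, LieModule.lowerCentralSeries_zero, eq_comm]
    simp [Submodule.eq_top_iff', mem_level]
  | succ k ih =>
    rw [gamma] at ih ⊢
    rw [LieModule.lowerCentralSeries_succ, LieSubmodule.lieIdeal_oper_eq_linear_span']
    have mem_iff : ∀ y, y ∈ LieModule.lowerCentralSeries ℚ (Tower σ d) (Tower σ d) k ↔
        y ∈ level σ d k := fun y => by rw [← ih]; rfl
    apply le_antisymm
    · rw [Submodule.span_le]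
      rintro _ ⟨x, -, y, hy, rfl⟩
      exact bracket_mem_level x ((mem_iff y).1 hy)
    · intro v hv
      rw [← sum_single v]
      refine Submodule.sum_mem _ fun i _ => ?_
      rcases lt_or_ge i.val (k + 1) with hi | hi
      · simp [hv i hi]
      cases i using Fin.cases with
      | zero => simp at hi
      | succ j =>
        have hjk : k ≤ j.val := by simpa using hi
        by_cases hj : j.val = 0
        -- Layer 1 has to be reached only from the whole algebra, so both arguments of the form may
        -- lie in layer 0.
        · have hk : k = 0 := by omega
          have key : (⊤ : Submodule ℚ E) ≤ (Submodule.span ℚ {m | ∃ x ∈ (⊤ : LieIdeal ℚ (Tower σ d)),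
              ∃ n ∈ LieModule.lowerCentralSeries ℚ (Tower σ d) (Tower σ d) k, ⁅x, n⁆ = m}).comap
              (single σ j.succ) := by
            rw [← show _ = _ from hσ, Submodule.span_le]
            rintro _ ⟨⟨a, b⟩, rfl⟩
            refine Submodule.subset_span ⟨_, trivial, single σ 0 b, (mem_iff _).2 ?_,
              bracket_single_zero hj a b⟩
            simp [mem_level, hk]
          exact key trivial
        · refine Submodule.subset_span ⟨_, trivial, single σ j.castSucc _, (mem_iff _).2 ?_,
            bracket_single_one hj _⟩
          intro l hl
          rw [single_apply, if_neg]
          rintro rfl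
          simp at hl
          omega

theorem gradedDim_eq (hσ : TwistSpans σ) {k : ℕ} (hk : k < d + 1) :
    gradedDim (Tower σ d) k = Module.finrank ℚ E := by
  rw [gradedDim, gamma_eq_level hσ, gamma_eq_level hσ]
  let ev : level σ d k →ₗ[ℚ] E :=
    (LinearMap.proj (R := ℚ) (φ := fun _ : Fin (d + 1) => E) ⟨k, hk⟩).comp (level σ d k).subtype
  have hev : ∀ v : level σ d k, ev v = v.1 ⟨k, hk⟩ := fun _ => rfl
  have hker : LinearMap.ker ev = (level σ d (k + 1)).submoduleOf (level σ d k) := by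
    ext v
    rw [LinearMap.mem_ker, hev, Submodule.submoduleOf, Submodule.mem_comap, mem_level]
    constructor
    · intro h i hi
      rcases Nat.lt_succ_iff_lt_or_eq.1 hi with h1 | h1
      · exact v.2 i h1
      · rw [← h]; exact congrArg v.1 (Fin.ext h1)
    · intro h
      exact h ⟨k, hk⟩ (Nat.lt_succ_self k)
  have hsurj : Function.Surjective ev := by
    intro e
    refine ⟨⟨single σ ⟨k, hk⟩ e, fun i hi => ?_⟩, single_self (σ := σ) _ _⟩
    rw [single_apply, if_neg]
    rintro rfl
    simp at hi
  rw [← hker]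
  exact (ev.quotKerEquivOfSurjective hsurj).finrank_eq

theorem lowerCentralSeries_eq_bot (hσ : TwistSpans σ) :
    LieModule.lowerCentralSeries ℚ (Tower σ d) (Tower σ d) (d + 1) = ⊥ := by
  rw [← LieSubmodule.toSubmodule_eq_bot]
  refine (gamma_eq_level hσ (d + 1)).trans ((Submodule.eq_bot_iff _).2 fun v hv => ?_)
  ext i
  exact hv i i.isLt

theorem isNilpotent (hσ : TwistSpans σ) : LieRing.IsNilpotent (Tower σ d) :=
  (LieModule.isNilpotent_iff ℚ _ _).2 ⟨_, lowerCentralSeries_eq_bot hσ⟩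

theorem nilpotencyLength_eq [Nontrivial E] (hσ : TwistSpans σ) :
    LieModule.nilpotencyLength (Tower σ d) (Tower σ d) = d + 1 := by
  rw [LieModule.nilpotencyLength_eq_succ_iff ℚ]
  refine ⟨lowerCentralSeries_eq_bot hσ, fun h => ?_⟩
  rw [← LieSubmodule.toSubmodule_eq_bot] at h
  have hmem : single σ (Fin.last d) 1 ∈ gamma (Tower σ d) d := by
    rw [gamma_eq_level hσ]
    intro i hi
    rw [single_apply, if_neg]
    rintro rfl
    simp at hi
  rw [gamma, h, Submodule.mem_bot] at hmem
  have := congrFun hmem (Fin.last d)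
  rw [single_self] at this
  exact one_ne_zero this

theorem lieType_eq [Nontrivial E] (hσ : TwistSpans σ) :
    lieType (Tower σ d) = List.replicate (d + 1) (Module.finrank ℚ E) := by
  rw [lieType, nilpotencyLength_eq hσ, List.eq_replicate_iff]
  refine ⟨by simp, fun b hb => ?_⟩
  obtain ⟨k, hk, rfl⟩ := List.mem_map.1 hb
  exact gradedDim_eq hσ (List.mem_range.1 hk)

/-- The weights by which a unit of `E` acts on the layers of a tower. -/
def weight (σ : E →ₐ[ℚ] E) (d : ℕ) (u : Eˣ) : Fin (d + 1) → Eˣ :=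
  Fin.cons u fun j : Fin d => u ^ (j.val + 1) * Units.map (σ : E →* E) u

/-- Multiplication of each layer of a tower by an element of `E`. -/
def scale (w : Fin (d + 1) → E) (v : Tower σ d) : Tower σ d := fun i => w i * v i

@[simp] theorem scale_apply (w : Fin (d + 1) → E) (v : Tower σ d) (i : Fin (d + 1)) :
    scale w v i = w i * v i := rfl

/-- The weights multiply along the bracket; this is what makes the scaling a Lie homomorphism. -/
theorem twist_weight_mul (u : Eˣ) (v : Tower σ d) (j : Fin d) :
    u * twist (scale (fun i => (weight σ d u i : E)) v) j =
      weight σ d u j.succ * twist v j := by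
  by_cases hj : j.val = 0
  · simp [twist, hj, weight]
    ring
  · obtain ⟨k, hk⟩ := exists_castSucc_eq_succ hj
    have hjk : j.val = k.val + 1 := by simpa using congrArg Fin.val hk
    simp [twist, weight, hk, hjk]
    ring

/-- The Lie algebra automorphism of a tower defined by a unit of `E`. -/
def unitEquiv (σ : E →ₐ[ℚ] E) (d : ℕ) (u : Eˣ) : Tower σ d ≃ₗ⁅ℚ⁆ Tower σ d where
  toFun := scale fun i => (weight σ d u i : E)
  map_add' v w := by ext i; simp [mul_add]
  map_smul' q v := by ext i; simp
  map_lie' {v w} := by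
    ext i
    cases i using Fin.cases with
    | zero => simp
    | succ j =>
      have h1 := twist_weight_mul u v j
      have h2 := twist_weight_mul u w j
      have h3 : (weight σ d u 0 : E) = u := rfl
      simp only [bracket_succ, scale_apply, h3]
      linear_combination w 0 * h1 - v 0 * h2
  invFun := scale fun i => ((weight σ d u i)⁻¹ : Eˣ)
  left_inv v := by ext i; simp
  right_inv v := by ext i; simp

end Tower

end Tower
-- Integrality and eigenvalues of multiplication operators.
section Linear

open Polynomial

theorem isIntegral_of_hasEigenvalue {V : Type*} [AddCommGroup V] [Module ℂ V]
    {f : Module.End ℂ V} (hf : IsIntegral ℤ f) {z : ℂ} (hz : f.HasEigenvalue z) :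
    IsIntegral ℤ z := by
  obtain ⟨p, hp, hpf⟩ := hf
  obtain ⟨v, hv⟩ := hz.exists_hasEigenvector
  refine ⟨p, hp, ?_⟩
  have h := Module.End.aeval_apply_of_hasEigenvector (p := p.map (algebraMap ℤ ℂ)) hv
  rw [aeval_map_algebraMap, aeval_def, hpf, LinearMap.zero_apply, eval_map] at h
  exact (smul_eq_zero.1 h.symm).resolve_right hv.2

/-- The complex eigenvalues are algebraic integers, hence so are the coefficients; being rational,
they are integers. -/
theorem exists_int_eq_coeff_charpoly {V : Type*} [AddCommGroup V] [Module ℚ V]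
    [FiniteDimensional ℚ V] {f : Module.End ℚ V} (hf : IsIntegral ℤ f) (k : ℕ) :
    ∃ a : ℤ, (f.charpoly.coeff k : ℚ) = a := by
  have hfC : IsIntegral ℤ (f.baseChange ℂ : Module.End ℂ (ℂ ⊗[ℚ] V)) :=
    hf.map (Module.End.baseChangeHom ℚ ℂ V).toRingHom.toIntAlgHom
  have hint : IsIntegral ℤ ((f.baseChange ℂ).charpoly.coeff k) := by
    refine isIntegral_coeff_of_factors _ ?_ (IsAlgClosed.splits _) (fun x hx => ?_) k
    · rw [(LinearMap.charpoly_monic _).leadingCoeff]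
      exact isIntegral_one
    · exact isIntegral_of_hasEigenvalue hfC
        ((Module.End.hasEigenvalue_iff_isRoot_charpoly _ _).2 hx)
  rw [LinearMap.charpoly_baseChange, coeff_map] at hint
  have := (isIntegral_algebraMap_iff (algebraMap ℚ ℂ).injective).1 hint
  obtain ⟨a, ha⟩ := IsIntegrallyClosed.isIntegral_iff.1 this
  exact ⟨a, ha.symm⟩

theorem exists_int_eq_det {V : Type*} [AddCommGroup V] [Module ℚ V]
    [FiniteDimensional ℚ V] {f : Module.End ℚ V} (hf : IsIntegral ℤ f) :
    ∃ a : ℤ, LinearMap.det f = (a : ℚ) := by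
  obtain ⟨a, ha⟩ := exists_int_eq_coeff_charpoly hf 0
  refine ⟨(-1) ^ Module.finrank ℚ V * a, ?_⟩
  rw [LinearMap.det_eq_sign_charpoly_coeff, ha]
  push_cast
  rfl

theorem isIntegerLike_of_isIntegral {V : Type*} [AddCommGroup V] [Module ℚ V]
    [FiniteDimensional ℚ V] {f g : Module.End ℚ V} (hf : IsIntegral ℤ f) (hg : IsIntegral ℤ g)
    (hfg : f * g = 1) : IsIntegerLike f := by
  refine ⟨exists_int_eq_coeff_charpoly hf, ?_⟩
  obtain ⟨a, ha⟩ := exists_int_eq_det hf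
  obtain ⟨b, hb⟩ := exists_int_eq_det hg
  have h : (a : ℚ) * b = 1 := by
    rw [← ha, ← hb, ← map_mul, hfg, map_one]
  have h' : IsUnit a := IsUnit.of_mul_eq_one b (by exact_mod_cast h)
  rw [ha]
  exact_mod_cast Int.isUnit_iff_abs_eq.1 h'

variable {E : Type*} [CommRing E] [Algebra ℚ E] [FiniteDimensional ℚ E]

/-- The element `1 ⊗ w - z` kills an eigenvector, so it lies in a maximal ideal of the finite
`ℂ`-algebra `ℂ ⊗ E`. The residue field maps to `ℂ` over `ℂ`, which sends `w` to `z`. `E` need not be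
a field. -/
theorem exists_algHom_eq_of_hasEigenvalue {w : E} {z : ℂ}
    (hz : Module.End.HasEigenvalue ((LinearMap.mulLeft ℚ w).baseChange ℂ) z) :
    ∃ φ : E →ₐ[ℚ] ℂ, φ w = z := by
  obtain ⟨v, hv⟩ := hz.exists_hasEigenvector
  have hmul : ∀ t : ℂ ⊗[ℚ] E, (LinearMap.mulLeft ℚ w).baseChange ℂ t = (1 ⊗ₜ[ℚ] w) * t := by
    intro t
    induction t with
    | zero => simp
    | tmul a b => simp
    | add a b ha hb => rw [map_add, ha, hb, mul_add]
  have hnu : (1 ⊗ₜ[ℚ] w - algebraMap ℂ (ℂ ⊗[ℚ] E) z) ∈ nonunits (ℂ ⊗[ℚ] E) := by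
    intro hu
    apply hv.2
    rw [← hu.mul_right_eq_zero, sub_mul, ← hmul, hv.apply_eq_smul, Algebra.smul_def, sub_self]
  obtain ⟨I, hI, hmem⟩ := exists_max_ideal_of_mem_nonunits hnu
  let := Ideal.Quotient.field I
  let ψ : ((ℂ ⊗[ℚ] E) ⧸ I) →ₐ[ℂ] ℂ := IsAlgClosed.lift
  refine ⟨((ψ.comp (Ideal.Quotient.mkₐ ℂ I)).restrictScalars ℚ).comp
    Algebra.TensorProduct.includeRight, ?_⟩
  have h0 : Ideal.Quotient.mkₐ ℂ I (1 ⊗ₜ[ℚ] w - algebraMap ℂ (ℂ ⊗[ℚ] E) z) = 0 :=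
    Ideal.Quotient.eq_zero_iff_mem.2 hmem
  have h1 := congrArg ψ h0
  rw [map_sub, map_sub, AlgHom.commutes, AlgHom.commutes, map_zero, sub_eq_zero] at h1
  exact h1

/-- Some component of an eigenvector is nonzero, and it is an eigenvector of multiplication by the
corresponding `w i`. -/
theorem isHyperbolic_pi_mul {ι : Type*} [Finite ι] {w : ι → E}
    (hw : ∀ (i : ι) (φ : E →ₐ[ℚ] ℂ), ‖φ (w i)‖ ≠ 1) :
    IsHyperbolic (LinearMap.mulLeft ℚ w) := by
  classical
  cases nonempty_fintype ι
  intro z hz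
  obtain ⟨v, hv⟩ := hz.exists_hasEigenvector
  have hsum : ∑ i, ((LinearMap.single ℚ (fun _ : ι => E) i).baseChange ℂ)
      ((LinearMap.proj (R := ℚ) (φ := fun _ : ι => E) i).baseChange ℂ v) = v := by
    generalize v = t
    induction t with
    | zero => simp
    | tmul a b =>
      simp only [LinearMap.baseChange_tmul, LinearMap.coe_proj, Function.eval,
        LinearMap.coe_single]
      rw [← TensorProduct.tmul_sum, Finset.univ_sum_single]
    | add a b ha hb => simp only [map_add, Finset.sum_add_distrib, ha, hb]
  obtain ⟨i, hi⟩ : ∃ i, (LinearMap.proj (R := ℚ) (φ := fun _ : ι => E) i).baseChange ℂ v ≠ 0 := by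
    by_contra! h
    apply hv.2
    rw [← hsum]
    simp [h]
  have hcomm : (LinearMap.proj (R := ℚ) (φ := fun _ : ι => E) i) ∘ₗ LinearMap.mulLeft ℚ w =
      LinearMap.mulLeft ℚ (w i) ∘ₗ LinearMap.proj i := by
    ext; simp
  have heig : Module.End.HasEigenvalue ((LinearMap.mulLeft ℚ (w i)).baseChange ℂ) z := by
    refine Module.End.hasEigenvalue_of_hasEigenvector ⟨Module.End.mem_eigenspace_iff.2 ?_, hi⟩
    have := congrArg (fun f => f.baseChange ℂ v) hcomm
    simp only [LinearMap.baseChange_comp, LinearMap.comp_apply, hv.apply_eq_smul, map_smul] at this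
    exact this.symm
  obtain ⟨φ, hφ⟩ := exists_algHom_eq_of_hasEigenvalue heig
  rw [← hφ]
  exact hw i φ

theorem isIntegral_mulLeft {R : Type*} [CommRing R] [Algebra ℚ R] {w : R} (hw : IsIntegral ℤ w) :
    IsIntegral ℤ (LinearMap.mulLeft ℚ w : Module.End ℚ R) :=
  hw.map (Algebra.lmul ℚ R).toRingHom.toIntAlgHom

theorem isIntegral_pi {ι : Type*} [Finite ι] {R : Type*} [CommRing R] {w : ι → R}
    (hw : ∀ i, IsIntegral ℤ (w i)) : IsIntegral ℤ w := by
  cases nonempty_fintype ι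
  choose p hp hpw using hw
  refine ⟨∏ i, p i, monic_prod_of_monic _ _ fun i _ => hp i, ?_⟩
  ext i
  rw [← aeval_def, ← Pi.evalAlgHom_apply (R := ℤ) (A := fun _ : ι => R) i (aeval w _),
    ← aeval_algHom_apply, map_prod]
  exact Finset.prod_eq_zero (Finset.mem_univ i) (hpw i)

theorem isAnosovAut_unitEquiv {σ : E →ₐ[ℚ] E} (d : ℕ) {u : Eˣ} (hu : IsIntegral ℤ (u : E))
    (hu' : IsIntegral ℤ ((u⁻¹ : Eˣ) : E))
    (hφ : ∀ φ : E →ₐ[ℚ] ℂ, ‖φ u‖ ≠ 1 ∧ ∀ k, 1 ≤ k → ‖φ u‖ ^ k * ‖φ (σ u)‖ ≠ 1) :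
    IsAnosovAut (Tower.unitEquiv σ d u) := by
  have hσ : ∀ {e : E}, IsIntegral ℤ e → IsIntegral ℤ (σ e) :=
    fun he => he.map σ.toRingHom.toIntAlgHom
  constructor
  -- As a linear map, the automorphism is by definition multiplication by the weight vector in the
  -- product ring.
  · refine isHyperbolic_pi_mul (w := fun i => (Tower.weight σ d u i : E)) fun i φ => ?_
    cases i using Fin.cases with
    | zero => exact (hφ φ).1
    | succ j => simpa [Tower.weight] using (hφ φ).2 (j.val + 1) (by omega)
  · refine isIntegerLike_of_isIntegral
      (g := LinearMap.mulLeft ℚ (fun i => ((Tower.weight σ d u i)⁻¹ : Eˣ) : Fin (d + 1) → E))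
      (isIntegral_mulLeft (w := fun i => (Tower.weight σ d u i : E)) (isIntegral_pi fun i => ?_))
      (isIntegral_mulLeft (isIntegral_pi fun i => ?_)) ?_
    · cases i using Fin.cases with
      | zero => exact hu
      | succ j => simpa [Tower.weight] using (hu.pow _).mul (hσ hu)
    · cases i using Fin.cases with
      | zero => exact hu'
      | succ j =>
        have := (hu'.pow (j.val + 1)).mul (hσ hu')
        simpa [Tower.weight, mul_comm] using this
    · apply LinearMap.ext
      exact (Tower.unitEquiv σ d u).right_inv

end Linear
-- Algebras with suitable units: products and quotients of the polynomial ring.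
section Twist

open Polynomial

/-- There is a commutative rational algebra of dimension `n`, an endomorphism `σ` of it, and an
integral unit `u` for which all towers over the algebra have type `(n, …, n)` and the automorphism
defined by `u` is Anosov. -/
def HasAnosovTowers (n : ℕ) : Prop :=
  ∃ (E : Type) (_ : CommRing E) (_ : Algebra ℚ E) (_ : FiniteDimensional ℚ E)
    (σ : E →ₐ[ℚ] E) (u : Eˣ), Module.finrank ℚ E = n ∧ IsIntegral ℤ (u : E) ∧
      IsIntegral ℤ ((u⁻¹ : Eˣ) : E) ∧ TwistSpans σ ∧
      ∀ φ : E →ₐ[ℚ] ℂ, ‖φ u‖ ≠ 1 ∧ ∀ k, 1 ≤ k → ‖φ u‖ ^ k * ‖φ (σ u)‖ ≠ 1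

theorem isIntegral_prod {R S : Type*} [CommRing R] [CommRing S] {r : R} {s : S}
    (hr : IsIntegral ℤ r) (hs : IsIntegral ℤ s) : IsIntegral ℤ (r, s) := by
  obtain ⟨p, hp, hpr⟩ := hr
  obtain ⟨q, hq, hqs⟩ := hs
  refine ⟨p * q, hp.mul hq, ?_⟩
  rw [← aeval_def] at hpr hqs ⊢
  ext
  · rw [← AlgHom.fst_apply (R := ℤ) (aeval (r, s) (p * q)), ← aeval_algHom_apply]
    simp [hpr]
  · rw [← AlgHom.snd_apply (R := ℤ) (aeval (r, s) (p * q)), ← aeval_algHom_apply]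
    simp [hqs]

/-- The idempotents `(1, 0)` and `(0, 1)` have product 0 and sum 1, so `φ` kills one of them. -/
theorem algHom_prod_cases {A B : Type*} [CommRing A] [CommRing B] [Algebra ℚ A] [Algebra ℚ B]
    (φ : A × B →ₐ[ℚ] ℂ) :
    (∃ ψ : A →ₐ[ℚ] ℂ, ∀ x, φ x = ψ x.1) ∨ ∃ ψ : B →ₐ[ℚ] ℂ, ∀ x, φ x = ψ x.2 := by
  have hmul : φ (1, 0) * φ (0, 1) = 0 := by 
    rw [← map_mul, ← map_zero φ, Prod.mk_mul_mk, zero_mul, mul_zero]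
    rfl
  have hadd : φ (1, 0) + φ (0, 1) = 1 := by
    rw [← map_add, ← map_one φ, Prod.mk_add_mk, zero_add, add_zero]; rfl
  have hsplit : ∀ x, φ x = φ (x.1, 0) + φ (0, x.2) := fun x => by rw [← map_add]; simp
  rcases mul_eq_zero.1 hmul with h | h
  · rw [h, zero_add] at hadd
    have h0 : ∀ a, φ (a, 0) = 0 := fun a => by
      have : (a, 0) = ((a, 0) : A × B) * (1, 0) := by simp
      rw [this, map_mul, h, mul_zero]
    refine .inr ⟨AlgHom.ofLinearMap (φ.toLinearMap.comp (LinearMap.inr ℚ A B)) (by simpa) ?_, ?_⟩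
    · intro x y
      simp [← map_mul]
    · intro x
      rw [hsplit x, h0, zero_add]
      rfl
  · rw [h, add_zero] at hadd
    have h0 : ∀ b, φ (0, b) = 0 := fun b => by
      have : (0, b) = ((0, b) : A × B) * (0, 1) := by simp
      rw [this, map_mul, h, mul_zero]
    refine .inl ⟨AlgHom.ofLinearMap (φ.toLinearMap.comp (LinearMap.inl ℚ A B)) (by simpa) ?_, ?_⟩
    · intro x y
      simp [← map_mul]
    · intro x
      rw [hsplit x, h0, add_zero]
      rfl

theorem TwistSpans.prod {A B : Type*} [CommRing A] [CommRing B] [Algebra ℚ A] [Algebra ℚ B]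
    {σ : A →ₐ[ℚ] A} {τ : B →ₐ[ℚ] B} (hσ : TwistSpans σ) (hτ : TwistSpans τ) :
    TwistSpans (σ.prodMap τ) := by
  rw [TwistSpans, eq_top_iff]
  set S := Submodule.span ℚ (Set.range fun p : (A × B) × (A × B) =>
    p.1 * σ.prodMap τ p.2 - p.2 * σ.prodMap τ p.1)
  have hA : ⊤ ≤ S.comap (LinearMap.inl ℚ A B) := by
    rw [← show _ = _ from hσ, Submodule.span_le]
    rintro _ ⟨⟨a, b⟩, rfl⟩
    exact Submodule.subset_span ⟨((a, 0), (b, 0)), by ext <;> simp [AlgHom.prodMap]⟩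
  have hB : ⊤ ≤ S.comap (LinearMap.inr ℚ A B) := by
    rw [← show _ = _ from hτ, Submodule.span_le]
    rintro _ ⟨⟨a, b⟩, rfl⟩
    exact Submodule.subset_span ⟨((0, a), (0, b)), by ext <;> simp [AlgHom.prodMap]⟩
  rintro ⟨a, b⟩ -
  have : (a, b) = LinearMap.inl ℚ A B a + LinearMap.inr ℚ A B b := by simp
  rw [this]
  exact S.add_mem (hA trivial) (hB trivial)

theorem HasAnosovTowers.add {m n : ℕ} (hm : HasAnosovTowers m) (hn : HasAnosovTowers n) :
    HasAnosovTowers (m + n) := by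
  obtain ⟨A, _, _, _, σ, u, rfl, hu, hu', hσ, hφ⟩ := hm
  obtain ⟨B, _, _, _, τ, v, rfl, hv, hv', hτ, hψ⟩ := hn
  refine ⟨A × B, inferInstance, inferInstance, inferInstance, σ.prodMap τ,
    MulEquiv.prodUnits.symm (u, v), Module.finrank_prod, isIntegral_prod hu hv,
    isIntegral_prod hu' hv', hσ.prod hτ, fun φ => ?_⟩
  rcases algHom_prod_cases φ with ⟨ψ, h⟩ | ⟨ψ, h⟩
  · rw [h, h]
    exact hφ ψ
  · rw [h, h]
    exact hψ ψ

/-- The algebra is `ℚ[X]/(p)` and the unit is the class of `X`; irreducibility plays no role. The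
divisibility makes `x ↦ x ^ 2 - 2` an endomorphism, so the norm conditions involve only one root at
a time. -/
theorem hasAnosovTowers_of_polynomial {p : ℤ[X]} (hp : p.Monic) (h0 : IsUnit (p.coeff 0))
    (hcomp : p ∣ p.comp (X ^ 2 - 2))
    (hspan : ∀ (A : Type) [CommRing A] [Algebra ℚ A] (x : A) (M : Submodule ℚ A),
      aeval x p = 0 → (∀ i j : ℕ, x ^ i * (x ^ 2 - 2) ^ j - x ^ j * (x ^ 2 - 2) ^ i ∈ M) →
      ∀ k < p.natDegree, x ^ k ∈ M)
    (hroot : ∀ z : ℂ, aeval z p = 0 →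
      ‖z‖ ≠ 1 ∧ ∀ k, 1 ≤ k → ‖z‖ ^ k * ‖z ^ 2 - 2‖ ≠ 1) :
    HasAnosovTowers p.natDegree := by
  set P : ℚ[X] := p.map (algebraMap ℤ ℚ) with hP
  have hPm : P.Monic := hp.map _
  set x : AdjoinRoot P := AdjoinRoot.root P with hx
  have hxp : aeval x p = 0 := by
    rw [← aeval_map_algebraMap ℚ]
    exact AdjoinRoot.aeval_eq P ▸ AdjoinRoot.mk_self
  have hσ : aeval (x ^ 2 - 2) P = 0 := by
    obtain ⟨q, hq⟩ := hcomp
    have := congrArg (aeval x) hq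
    rw [map_mul, hxp, zero_mul, aeval_comp] at this
    refine (aeval_map_algebraMap ℚ _ _).trans ?_
    simpa [map_ofNat (aeval x) 2] using this
  let pb := AdjoinRoot.powerBasis' hPm
  have hpbdim : pb.dim = p.natDegree := by
    rw [← hp.natDegree_map (algebraMap ℤ ℚ)]
    exact AdjoinRoot.powerBasis'_dim hPm
  let σ : AdjoinRoot P →ₐ[ℚ] AdjoinRoot P :=
    AdjoinRoot.liftAlgHom P (Algebra.ofId _ _) (x ^ 2 - 2) hσ
  have hσx : σ x = x ^ 2 - 2 := AdjoinRoot.liftAlgHom_root ..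
  have hunit : ∃ y : AdjoinRoot P, x * y = 1 ∧ IsIntegral ℤ y := by
    have hdiv := congrArg (aeval x) (divX_mul_X_add p)
    rw [hxp, map_add, map_mul, aeval_X, aeval_C] at hdiv
    have hxi : IsIntegral ℤ x := ⟨p, hp, hxp⟩
    obtain ⟨ε, hε⟩ := h0.exists_right_inv
    -- From `p(x) = 0` one gets `x * divX p (x) = -p(0)`, and `ε` inverts `p(0)`.
    refine ⟨-(algebraMap ℤ _ ε * aeval x p.divX), ?_, ?_⟩
    · have hε' := congrArg (algebraMap ℤ (AdjoinRoot P)) hε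
      rw [map_mul, map_one] at hε'
      linear_combination hε' - algebraMap ℤ (AdjoinRoot P) ε * hdiv
    · exact (isIntegral_algebraMap.mul
        (adjoin_le_integralClosure hxi (aeval_mem_adjoin_singleton ℤ x))).neg
  obtain ⟨y, hxy, hy⟩ := hunit
  refine ⟨AdjoinRoot P, inferInstance, inferInstance, pb.finite, σ,
    ⟨x, y, hxy, by rw [mul_comm, hxy]⟩, pb.finrank.trans hpbdim, (⟨p, hp, hxp⟩ : IsIntegral ℤ x), hy,
    ?_, fun φ => ?_⟩
  · rw [TwistSpans, eq_top_iff, ← pb.basis.span_eq, Submodule.span_le]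
    rintro _ ⟨i, rfl⟩
    rw [pb.basis_eq_pow]
    have hmem : ∀ i j : ℕ, x ^ i * (x ^ 2 - 2) ^ j - x ^ j * (x ^ 2 - 2) ^ i ∈
        Submodule.span ℚ (Set.range fun p : AdjoinRoot P × AdjoinRoot P =>
          p.1 * σ p.2 - p.2 * σ p.1) := fun i j =>
      Submodule.subset_span ⟨(x ^ i, x ^ j), by simp [hσx]⟩
    exact hspan _ x _ hxp hmem _ (hpbdim ▸ i.isLt)
  · have hz : aeval (φ x) p = 0 := by
      have := congrArg φ hxp
      rwa [← AlgHom.restrictScalars_apply ℤ, ← aeval_algHom_apply, map_zero] at this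
    have := hroot _ hz
    simpa [hσx, map_ofNat φ 2] using this

/-! ### Isolating the roots and checking the norm conditions on intervals. -/

theorem exists_eq_ofReal_of_aeval_eq_zero {p : ℤ[X]} (hp : p ≠ 0) {s : Finset ℝ}
    (hs : ∀ r ∈ s, aeval r p = 0) (hcard : p.natDegree ≤ s.card) {z : ℂ} (hz : aeval z p = 0) :
    ∃ r ∈ s, z = (r : ℂ) := by
  classical
  by_contra! h
  have hinj : Function.Injective (fun r : ℝ => (r : ℂ)) := Complex.ofReal_injective
  have hz' : z ∉ s.image (fun r : ℝ => (r : ℂ)) := by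
    simp only [Finset.mem_image, not_exists, not_and]
    exact fun r hr h' => h r hr h'.symm
  have hp' : p.map (algebraMap ℤ ℂ) ≠ 0 :=
    (Polynomial.map_ne_zero_iff (RingHom.injective_int _)).2 hp
  have hle : (insert z (s.image (fun r : ℝ => (r : ℂ)))).card ≤
      (p.map (algebraMap ℤ ℂ)).natDegree := by
    refine card_le_degree_of_subset_roots fun w hw => ?_
    rw [mem_roots hp', IsRoot, eval_map_algebraMap]
    rcases Finset.mem_insert.1 hw with rfl | hw
    · exact hz
    · obtain ⟨r, hr, rfl⟩ := Finset.mem_image.1 hw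
      have := aeval_algebraMap_apply ℂ r p
      rw [hs r hr, map_zero] at this
      exact this
  rw [Finset.card_insert_of_notMem hz', Finset.card_image_of_injective _ hinj] at hle
  have := natDegree_map_le (f := algebraMap ℤ ℂ) (p := p)
  omega

theorem exists_root_mem_Ioo {p : ℤ[X]} {a b : ℝ} (hab : a ≤ b)
    (h : aeval a p * aeval b p < 0) : ∃ r, a < r ∧ r < b ∧ aeval r p = 0 := by
  have hc : ContinuousOn (fun r : ℝ => aeval r p) (Set.Icc a b) :=
    p.continuous_aeval.continuousOn
  rcases mul_neg_iff.1 h with ⟨h1, h2⟩ | ⟨h1, h2⟩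
  · obtain ⟨r, hr, h⟩ := intermediate_value_Ioo' hab hc ⟨h2, h1⟩
    exact ⟨r, hr.1, hr.2, h⟩
  · obtain ⟨r, hr, h⟩ := intermediate_value_Ioo hab hc ⟨h1, h2⟩
    exact ⟨r, hr.1, hr.2, h⟩

theorem lt_abs_sq_sub_two_lt {r a b c d : ℝ} (ha : 0 ≤ a) (hr : a < |r| ∧ |r| < b)
    (hcd : (c ≤ a ^ 2 - 2 ∧ b ^ 2 - 2 ≤ d) ∨ (c ≤ 2 - b ^ 2 ∧ 2 - a ^ 2 ≤ d))
    (hc : 0 < c) : c < |r ^ 2 - 2| ∧ |r ^ 2 - 2| < d := by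
  have h1 : a ^ 2 < r ^ 2 := by rw [← sq_abs r]; gcongr; exact hr.1
  have h2 : r ^ 2 < b ^ 2 := by rw [← sq_abs r]; gcongr; exact hr.2
  rcases hcd with ⟨h3, h4⟩ | ⟨h3, h4⟩
  · rw [abs_of_pos (by linarith)]
    constructor <;> linarith
  · rw [abs_of_neg (by linarith)]
    constructor <;> linarith

/-- The product grows with `k`, so it suffices that it passes 1 strictly between the exponents `m`
and `m + 1`. For `m = 0` nothing needs checking below the crossing. -/
theorem abs_conditions_of_gt_one {r a b c d : ℝ} (m : ℕ) (hr : a < |r| ∧ |r| < b) (ha : 1 < a)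
    (hc : 0 < c) (hcd : (c ≤ a ^ 2 - 2 ∧ b ^ 2 - 2 ≤ d) ∨ (c ≤ 2 - b ^ 2 ∧ 2 - a ^ 2 ≤ d))
    (h1 : m = 0 ∨ b ^ m * d ≤ 1) (h2 : 1 ≤ a ^ (m + 1) * c) :
    |r| ≠ 1 ∧ ∀ k, 1 ≤ k → |r| ^ k * |r ^ 2 - 2| ≠ 1 := by
  obtain ⟨hcr, hrd⟩ := lt_abs_sq_sub_two_lt (by linarith) hr hcd hc
  have hr1 : 1 < |r| := ha.trans hr.1
  refine ⟨hr1.ne', fun k hk => ?_⟩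
  rcases Nat.lt_or_ge m k with h | h
  · refine ne_of_gt (h2.trans_lt ?_)
    calc a ^ (m + 1) * c < |r| ^ (m + 1) * |r ^ 2 - 2| := by gcongr; exact hr.1
      _ ≤ |r| ^ k * |r ^ 2 - 2| := by gcongr; exacts [hr1.le, h]
  · refine ne_of_lt (lt_of_lt_of_le ?_ (h1.resolve_left (by omega)))
    calc |r| ^ k * |r ^ 2 - 2| ≤ |r| ^ m * |r ^ 2 - 2| := by gcongr; exact hr1.le
      _ < b ^ m * d := by gcongr <;> first | omega | exact hr.2

/-- Here the product decreases with `k`, and again crosses 1 between `m` and `m + 1`. -/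
theorem abs_conditions_of_lt_one {r a b c d : ℝ} (m : ℕ) (hr : a < |r| ∧ |r| < b) (ha : 0 < a)
    (hb : b < 1) (hc : 0 < c)
    (hcd : (c ≤ a ^ 2 - 2 ∧ b ^ 2 - 2 ≤ d) ∨ (c ≤ 2 - b ^ 2 ∧ 2 - a ^ 2 ≤ d))
    (h1 : m = 0 ∨ 1 ≤ a ^ m * c) (h2 : b ^ (m + 1) * d ≤ 1) :
    |r| ≠ 1 ∧ ∀ k, 1 ≤ k → |r| ^ k * |r ^ 2 - 2| ≠ 1 := by
  obtain ⟨hcr, hrd⟩ := lt_abs_sq_sub_two_lt ha.le hr hcd hc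
  have hr1 : |r| < 1 := hr.2.trans hb
  have hr0 : 0 < |r| := ha.trans hr.1
  refine ⟨hr1.ne, fun k hk => ?_⟩
  rcases Nat.lt_or_ge m k with h | h
  · refine ne_of_lt (lt_of_lt_of_le ?_ h2)
    calc |r| ^ k * |r ^ 2 - 2| ≤ |r| ^ (m + 1) * |r ^ 2 - 2| :=
          mul_le_mul_of_nonneg_right (pow_le_pow_of_le_one hr0.le hr1.le h) (abs_nonneg _)
      _ < b ^ (m + 1) * d := by gcongr; exact hr.2
  · refine ne_of_gt (lt_of_le_of_lt (h1.resolve_left (by omega)) ?_)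
    calc a ^ m * c < |r| ^ m * |r ^ 2 - 2| := by gcongr <;> first | omega | exact hr.1
      _ ≤ |r| ^ k * |r ^ 2 - 2| :=
          mul_le_mul_of_nonneg_right (pow_le_pow_of_le_one hr0.le hr1.le h) (abs_nonneg _)

/-- A sign change on each of `n` ordered intervals gives `n` distinct real roots, which are then all
the complex roots. -/
theorem root_conditions_of_intervals {n : ℕ} {p : ℤ[X]} (hp : p ≠ 0) (hdeg : p.natDegree = n)
    (lo hi : Fin n → ℝ) (hle : ∀ i, lo i ≤ hi i) (hsep : ∀ i j, i < j → hi i ≤ lo j)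
    (hsign : ∀ i, aeval (lo i) p * aeval (hi i) p < 0)
    (hcond : ∀ i r, lo i < r → r < hi i → |r| ≠ 1 ∧ ∀ k, 1 ≤ k → |r| ^ k * |r ^ 2 - 2| ≠ 1)
    (z : ℂ) (hz : aeval z p = 0) :
    ‖z‖ ≠ 1 ∧ ∀ k, 1 ≤ k → ‖z‖ ^ k * ‖z ^ 2 - 2‖ ≠ 1 := by
  classical
  choose r hlo hhi hr using fun i => exists_root_mem_Ioo (hle i) (hsign i)
  have hmono : StrictMono r := fun i j hij => (hhi i).trans_le ((hsep i j hij).trans (hlo j).le)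
  obtain ⟨_, hs, rfl⟩ := exists_eq_ofReal_of_aeval_eq_zero (s := Finset.univ.image r) hp
    (by simpa using hr) (by rw [Finset.card_image_of_injective _ hmono.injective]; simp [hdeg]) hz
  obtain ⟨i, -, rfl⟩ := Finset.mem_image.1 hs
  have h2 : ((r i : ℂ)) ^ 2 - 2 = ((r i ^ 2 - 2 : ℝ) : ℂ) := by push_cast; rfl
  rw [h2, Complex.norm_real, Complex.norm_real]
  exact hcond i (r i) (hlo i) (hhi i)

end Twist
-- Real cyclotomic examples in degrees 3, 4 and 5.
section Main

open Polynomial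

theorem hasAnosovTowers_three : HasAnosovTowers 3 := by
  have hdeg : (X ^ 3 + X ^ 2 - 2 * X - 1 : ℤ[X]).natDegree = 3 := by compute_degree!
  have hmonic : (X ^ 3 + X ^ 2 - 2 * X - 1 : ℤ[X]).Monic := by monicity!
  have hev : ∀ {A : Type} [CommRing A] (x : A),
      aeval x (X ^ 3 + X ^ 2 - 2 * X - 1 : ℤ[X]) =
        x ^ 3 + x ^ 2 - 2 * x - 1 := fun x => by
    simp [map_ofNat (aeval x) 2]
  rw [← hdeg]
  refine hasAnosovTowers_of_polynomial hmonic (by simp) ?_ ?_ ?_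
  -- The cofactor is `p(-X)` up to sign: `x ^ 2 - 2` doubles the angle of `x = 2 cos θ` and is even
  -- in `x`.
  · refine ⟨X ^ 3 - X ^ 2 - 2 * X + 1, ?_⟩
    simp only [add_comp, sub_comp, mul_comp, pow_comp, X_comp, ofNat_comp, one_comp]
    ring
  · intro A _ _ x M hx b i hi
    rw [hdeg] at hi
    rw [hev] at hx
    -- Modulo `p`, the form values on pairs of powers of `x` give every `7 * x ^ i` as an integer
    -- combination. The coefficients below solve that linear system; the factor of `hx` is the
    -- quotient on division by `p`.
    refine (M.smul_mem_iff (by norm_num : (7 : ℚ) ≠ 0)).1 ?_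
    rw [ofNat_smul_eq_nsmul]
    have key (k l m : ℤ) := M.add_mem (M.add_mem (zsmul_mem (b 0 1) k)
      (zsmul_mem (b 0 2) l))
      (zsmul_mem (b 1 2) m)
    interval_cases i
    · convert key (-5) (-1) (-3) using 1
      simp only [zsmul_eq_mul, nsmul_eq_mul]
      push_cast
      linear_combination (3 * x ^ 2 - 5 * x - 1) * hx
    · convert key (-3) (-2) 1 using 1
      simp only [zsmul_eq_mul, nsmul_eq_mul]
      push_cast
      linear_combination (-x ^ 2 + 4 * x - 2) * hx
    · convert key (-6) (-4) (-5) using 1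
      simp only [zsmul_eq_mul, nsmul_eq_mul]
      push_cast
      linear_combination (5 * x ^ 2 - 6 * x - 4) * hx
  · refine root_conditions_of_intervals hmonic.ne_zero hdeg
      -- Enclosures of `2 cos (2πk/7)` for `k = 3, 2, 1`.
      ![-181/100, -9/20, 31/25] ![-9/5, -11/25, 5/4] ?_ ?_ ?_ ?_
    · intro i
      fin_cases i <;> norm_num
    · intro i j hij
      fin_cases i <;> fin_cases j <;> first | exact absurd hij (by decide) | norm_num
    · intro i
      rw [hev, hev]
      fin_cases i <;> norm_num
    · intro i r h1 h2
      fin_cases i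
      · change (-181/100 : ℝ) < r at h1
        change r < (-9/5 : ℝ) at h2
        have hr : (9/5 : ℝ) < |r| ∧ |r| < (181/100 : ℝ) := by
          rw [abs_of_neg (by linarith)]
          constructor <;> linarith
        exact abs_conditions_of_gt_one (c := 31/25) (d := 12761/10000) 0 hr (by norm_num)
          (by norm_num)
          (.inl ⟨by norm_num, by norm_num⟩) (.inl rfl) (by norm_num)
      · change (-9/20 : ℝ) < r at h1
        change r < (-11/25 : ℝ) at h2
        have hr : (11/25 : ℝ) < |r| ∧ |r| < (9/20 : ℝ) := by
          rw [abs_of_neg (by linarith)]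
          constructor <;> linarith
        exact abs_conditions_of_lt_one (c := 719/400) (d := 1129/625) 0 hr (by norm_num)
          (by norm_num)
          (by norm_num) (.inr ⟨by norm_num, by norm_num⟩) (.inl rfl) (by norm_num)
      · change (31/25 : ℝ) < r at h1
        change r < (5/4 : ℝ) at h2
        have hr : (31/25 : ℝ) < |r| ∧ |r| < (5/4 : ℝ) := by
          rw [abs_of_pos (by linarith)]
          constructor <;> linarith
        exact abs_conditions_of_gt_one (c := 7/16) (d := 289/625) 3 hr (by norm_num)
          (by norm_num)
          (.inr ⟨by norm_num, by norm_num⟩) (.inr (by norm_num)) (by norm_num)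

theorem hasAnosovTowers_four : HasAnosovTowers 4 := by
  have hdeg : (X ^ 4 - X ^ 3 - 4 * X ^ 2 + 4 * X + 1 : ℤ[X]).natDegree = 4 := by compute_degree!
  have hmonic : (X ^ 4 - X ^ 3 - 4 * X ^ 2 + 4 * X + 1 : ℤ[X]).Monic := by monicity!
  have hev : ∀ {A : Type} [CommRing A] (x : A),
      aeval x (X ^ 4 - X ^ 3 - 4 * X ^ 2 + 4 * X + 1 : ℤ[X]) =
        x ^ 4 - x ^ 3 - 4 * x ^ 2 + 4 * x + 1 := fun x => by
    simp [map_ofNat (aeval x) 4]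
  rw [← hdeg]
  refine hasAnosovTowers_of_polynomial hmonic (by simp) ?_ ?_ ?_
  · refine ⟨X ^ 4 + X ^ 3 - 4 * X ^ 2 - 4 * X + 1, ?_⟩
    simp only [add_comp, sub_comp, mul_comp, pow_comp, X_comp, ofNat_comp, one_comp]
    ring
  · intro A _ _ x M hx b i hi
    rw [hdeg] at hi
    rw [hev] at hx
    refine (M.smul_mem_iff (by norm_num : (15 : ℚ) ≠ 0)).1 ?_
    rw [ofNat_smul_eq_nsmul]
    have key (k l m n : ℤ) := M.add_mem (M.add_mem (M.add_mem (zsmul_mem (b 0 1) k)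
      (zsmul_mem (b 0 2) l))
      (zsmul_mem (b 0 3) m))
      (zsmul_mem (b 1 2) n)
    interval_cases i
    · convert key (-7) (-2) (-1) (-4) using 1
      simp only [zsmul_eq_mul, nsmul_eq_mul]
      push_cast
      linear_combination (x ^ 2 + 5 * x + 1) * hx
    · convert key 2 (-8) (-4) (-1) using 1
      simp only [zsmul_eq_mul, nsmul_eq_mul]
      push_cast
      linear_combination (4 * x ^ 2 + 5 * x + 4) * hx
    · convert key 3 (-12) (-6) (-9) using 1
      simp only [zsmul_eq_mul, nsmul_eq_mul]
      push_cast
      linear_combination (6 * x ^ 2 + 15 * x + 6) * hx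
    · convert key 32 (-23) (-19) (-1) using 1
      simp only [zsmul_eq_mul, nsmul_eq_mul]
      push_cast
      linear_combination (19 * x ^ 2 + 20 * x + 4) * hx
  · refine root_conditions_of_intervals hmonic.ne_zero hdeg
      -- Enclosures of `2 cos (2πk/15)` for `k = 7, 4, 2, 1`.
      ![-49/25, -21/100, 133/100, 91/50] ![-39/20, -1/5, 67/50, 183/100] ?_ ?_ ?_ ?_
    · intro i
      fin_cases i <;> norm_num
    · intro i j hij
      fin_cases i <;> fin_cases j <;> first | exact absurd hij (by decide) | norm_num
    · intro i
      rw [hev, hev]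
      fin_cases i <;> norm_num
    · intro i r h1 h2
      fin_cases i
      · change (-49/25 : ℝ) < r at h1
        change r < (-39/20 : ℝ) at h2
        have hr : (39/20 : ℝ) < |r| ∧ |r| < (49/25 : ℝ) := by
          rw [abs_of_neg (by linarith)]
          constructor <;> linarith
        exact abs_conditions_of_gt_one (c := 721/400) (d := 1151/625) 0 hr (by norm_num)
          (by norm_num)
          (.inl ⟨by norm_num, by norm_num⟩) (.inl rfl) (by norm_num)
      · change (-21/100 : ℝ) < r at h1
        change r < (-1/5 : ℝ) at h2
        have hr : (1/5 : ℝ) < |r| ∧ |r| < (21/100 : ℝ) := by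
          rw [abs_of_neg (by linarith)]
          constructor <;> linarith
        exact abs_conditions_of_lt_one (c := 19559/10000) (d := 49/25) 0 hr (by norm_num)
          (by norm_num)
          (by norm_num) (.inr ⟨by norm_num, by norm_num⟩) (.inl rfl) (by norm_num)
      · change (133/100 : ℝ) < r at h1
        change r < (67/50 : ℝ) at h2
        have hr : (133/100 : ℝ) < |r| ∧ |r| < (67/50 : ℝ) := by
          rw [abs_of_pos (by linarith)]
          constructor <;> linarith
        exact abs_conditions_of_gt_one (c := 511/2500) (d := 2311/10000) 5 hr (by norm_num)
          (by norm_num)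
          (.inr ⟨by norm_num, by norm_num⟩) (.inr (by norm_num)) (by norm_num)
      · change (91/50 : ℝ) < r at h1
        change r < (183/100 : ℝ) at h2
        have hr : (91/50 : ℝ) < |r| ∧ |r| < (183/100 : ℝ) := by
          rw [abs_of_pos (by linarith)]
          constructor <;> linarith
        exact abs_conditions_of_gt_one (c := 3281/2500) (d := 13489/10000) 0 hr (by norm_num)
          (by norm_num)
          (.inl ⟨by norm_num, by norm_num⟩) (.inl rfl) (by norm_num)

theorem hasAnosovTowers_five : HasAnosovTowers 5 := by
  have hdeg : (X ^ 5 + X ^ 4 - 4 * X ^ 3 - 3 * X ^ 2 + 3 * X + 1 : ℤ[X]).natDegree = 5 := by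
    compute_degree!
  have hmonic : (X ^ 5 + X ^ 4 - 4 * X ^ 3 - 3 * X ^ 2 + 3 * X + 1 : ℤ[X]).Monic := by monicity!
  have hev : ∀ {A : Type} [CommRing A] (x : A),
      aeval x (X ^ 5 + X ^ 4 - 4 * X ^ 3 - 3 * X ^ 2 + 3 * X + 1 : ℤ[X]) =
        x ^ 5 + x ^ 4 - 4 * x ^ 3 - 3 * x ^ 2 + 3 * x + 1 := fun x => by
    simp [map_ofNat (aeval x) 3, map_ofNat (aeval x) 4]
  rw [← hdeg]
  refine hasAnosovTowers_of_polynomial hmonic (by simp) ?_ ?_ ?_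
  · refine ⟨X ^ 5 - X ^ 4 - 4 * X ^ 3 + 3 * X ^ 2 + 3 * X - 1, ?_⟩
    simp only [add_comp, sub_comp, mul_comp, pow_comp, X_comp, ofNat_comp, one_comp]
    ring
  · intro A _ _ x M hx b i hi
    rw [hdeg] at hi
    rw [hev] at hx
    refine (M.smul_mem_iff (by norm_num : (11 : ℚ) ≠ 0)).1 ?_
    rw [ofNat_smul_eq_nsmul]
    have key (k l m n r : ℤ) := M.add_mem (M.add_mem (M.add_mem (M.add_mem (zsmul_mem (b 0 1) k)
      (zsmul_mem (b 0 2) l))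
      (zsmul_mem (b 0 3) m))
      (zsmul_mem (b 0 4) n))
      (zsmul_mem (b 1 2) r)
    interval_cases i
    · convert key (-21) (-30) 4 8 (-5) using 1
      simp only [zsmul_eq_mul, nsmul_eq_mul]
      push_cast
      linear_combination (-8 * x ^ 3 + 8 * x ^ 2 + 20 * x - 7) * hx
    · convert key 2 17 (-3) (-6) 1 using 1
      simp only [zsmul_eq_mul, nsmul_eq_mul]
      push_cast
      linear_combination (6 * x ^ 3 - 6 * x ^ 2 - 15 * x + 8) * hx
    · convert key (-29) (-43) 5 10 (-9) using 1
      simp only [zsmul_eq_mul, nsmul_eq_mul]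
      push_cast
      linear_combination (-10 * x ^ 3 + 10 * x ^ 2 + 25 * x - 6) * hx
    · convert key 19 35 (-12) (-13) 4 using 1
      simp only [zsmul_eq_mul, nsmul_eq_mul]
      push_cast
      linear_combination (13 * x ^ 3 - 13 * x ^ 2 - 27 * x + 10) * hx
    · convert key (-61) (-84) 9 18 (-25) using 1
      simp only [zsmul_eq_mul, nsmul_eq_mul]
      push_cast
      linear_combination (-18 * x ^ 3 + 18 * x ^ 2 + 45 * x - 2) * hx
  · refine root_conditions_of_intervals hmonic.ne_zero hdeg
      -- Enclosures of `2 cos (2πk/11)` for `k = 5, 4, 3, 2, 1`.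
      ![-48/25, -131/100, -29/100, 83/100, 42/25]
      ![-191/100, -13/10, -7/25, 21/25, 169/100] ?_ ?_ ?_ ?_
    · intro i
      fin_cases i <;> norm_num
    · intro i j hij
      fin_cases i <;> fin_cases j <;> first | exact absurd hij (by decide) | norm_num
    · intro i
      rw [hev, hev]
      fin_cases i <;> norm_num
    · intro i r h1 h2
      fin_cases i
      · change (-48/25 : ℝ) < r at h1
        change r < (-191/100 : ℝ) at h2
        have hr : (191/100 : ℝ) < |r| ∧ |r| < (48/25 : ℝ) := by
          rw [abs_of_neg (by linarith)]
          constructor <;> linarith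
        exact abs_conditions_of_gt_one (c := 16481/10000) (d := 1054/625) 0 hr (by norm_num)
          (by norm_num)
          (.inl ⟨by norm_num, by norm_num⟩) (.inl rfl) (by norm_num)
      · change (-131/100 : ℝ) < r at h1
        change r < (-13/10 : ℝ) at h2
        have hr : (13/10 : ℝ) < |r| ∧ |r| < (131/100 : ℝ) := by
          rw [abs_of_neg (by linarith)]
          constructor <;> linarith
        exact abs_conditions_of_gt_one (c := 2839/10000) (d := 31/100) 4 hr (by norm_num)
          (by norm_num)
          (.inr ⟨by norm_num, by norm_num⟩) (.inr (by norm_num)) (by norm_num)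
      · change (-29/100 : ℝ) < r at h1
        change r < (-7/25 : ℝ) at h2
        have hr : (7/25 : ℝ) < |r| ∧ |r| < (29/100 : ℝ) := by
          rw [abs_of_neg (by linarith)]
          constructor <;> linarith
        exact abs_conditions_of_lt_one (c := 19159/10000) (d := 1201/625) 0 hr (by norm_num)
          (by norm_num)
          (by norm_num) (.inr ⟨by norm_num, by norm_num⟩) (.inl rfl) (by norm_num)
      · change (83/100 : ℝ) < r at h1
        change r < (21/25 : ℝ) at h2
        have hr : (83/100 : ℝ) < |r| ∧ |r| < (21/25 : ℝ) := by
          rw [abs_of_pos (by linarith)]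
          constructor <;> linarith
        exact abs_conditions_of_lt_one (c := 809/625) (d := 13111/10000) 1 hr (by norm_num)
          (by norm_num)
          (by norm_num) (.inr ⟨by norm_num, by norm_num⟩) (.inr (by norm_num)) (by norm_num)
      · change (42/25 : ℝ) < r at h1
        change r < (169/100 : ℝ) at h2
        have hr : (42/25 : ℝ) < |r| ∧ |r| < (169/100 : ℝ) := by
          rw [abs_of_pos (by linarith)]
          constructor <;> linarith
        exact abs_conditions_of_gt_one (c := 514/625) (d := 8561/10000) 0 hr (by norm_num)
          (by norm_num)
          (.inl ⟨by norm_num, by norm_num⟩) (.inl rfl) (by norm_num)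

theorem hasAnosovTowers (n : ℕ) (hn : 2 < n) : HasAnosovTowers n := by
  induction n using Nat.strong_induction_on with
  | _ n ih =>
    by_cases h : n < 6
    · interval_cases n
      exacts [hasAnosovTowers_three, hasAnosovTowers_four, hasAnosovTowers_five]
    · obtain ⟨m, rfl⟩ := Nat.exists_eq_add_of_le' (show 3 ≤ n by omega)
      exact (ih m (by omega) (by omega)).add hasAnosovTowers_three

end Main

end AnosovLie

theorem mainTheorem4 (c n : ℕ) (hc : 1 ≤ c) (hn : 2 < n) :
    ∃ (L : Type) (_ : LieRing L) (_ : LieAlgebra ℚ L) (_ : FiniteDimensional ℚ L),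
      AnosovLie.IsAnosov L ∧
      LieRing.IsNilpotent L ∧
      LieModule.nilpotencyLength L L = c ∧
      AnosovLie.lieType L = List.replicate c n := by
  obtain ⟨d, rfl⟩ := Nat.exists_eq_add_of_le' hc
  obtain ⟨E, _, _, _, σ, u, rfl, hu, hu', hσ, hφ⟩ := AnosovLie.hasAnosovTowers n hn
  have : Nontrivial E := Module.nontrivial_of_finrank_pos (R := ℚ) (by omega)
  exact ⟨AnosovLie.Tower σ d, inferInstance, inferInstance, inferInstance,
    ⟨_, AnosovLie.isAnosovAut_unitEquiv d hu hu' hφ⟩, AnosovLie.Tower.isNilpotent hσ,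
    AnosovLie.Tower.nilpotencyLength_eq hσ, AnosovLie.Tower.lieType_eq hσ⟩
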